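/- Let $n\ge 1$, $d\ge 0$, $T\ge 0$ be integers, $\mathcal Z$ a set, and $\ell:\mathbb R^d\times\mathcal Z\to\mathbb R$ a loss such that, for every $z$, $w\mapsto\ell(w,z)$ is differentiable with $\|\nabla_w\ell(w,z)\|_2\le G$ for all $w$, where $G>0$. Let $\beta_0>0$, $0<\delta\le 1$ and $n\delta<2.5$, and set $$\eta_t=\frac{G^{-1}\sqrt{\beta_0}}{\sqrt{8\,\ln\!\big(2.5\,t^2/(n\delta)\big)\,t}}\quad(t\ge 1),\qquad \lambda_t=\frac1{\eta_t}-\frac1{\eta_{t-1}}\quad(t\ge 2).$$ Consider the following algorithm (DP-SGD with batch size $1$, sampling with replacement) on a dataset $S_n=(z_1,\dots,z_n)\in\mathcal Z^n$. Draw $w_1\sim N(0,\beta_0 I)$. For $t=2,\dots,T$, draw an index $i_{t-1}$ uniformly from $\{1,\dots,n\}$, independently of everything before, put $\tilde w_{t-1}=w_{t-1}-\eta_t\nabla_w\ell(w_{t-1},z_{i_{t-1}})$, and draw $$w_t\sim N\big((1-\lambda_t\eta_t)\,\tilde w_{t-1},\ \lambda_t\eta_t(2-\lambda_t\eta_t)\,\beta_0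 I\big).$$ The output is the whole sequence of iterates $(w_1,\dots,w_T)\in(\mathbb R^d)^T$. Then the algorithm is $(\epsilon,\delta)$-differentially private with $$\epsilon=\sqrt{2T\ln(2/\delta)}\;\frac{e}{n}+\frac{T e^2}{n^2},$$ that is, for any two datasets $S_n,S_n'\in\mathcal Z^n$ differing in at most one item and every measurable $E\subseteq(\mathbb R^d)^T$, $$P\big((w_1,\dots,w_T)(S_n)\in E\big)\le e^{\epsilon}\,P\big((w_1,\dots,w_T)(S_n')\in E\big)+\delta .$$ -/

import Mathlib

open MeasureTheory ProbabilityTheory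
open scoped ENNReal

noncomputable section

/-- Two datasets of size `n` are neighbours if they differ in at most one item. -/
def Neighboring {Z : Type*} {n : ℕ} (S S' : Fin n → Z) : Prop :=
  {j | S j ≠ S' j}.Subsingleton

/-- `(ε, δ)`-differential privacy of a randomized algorithm on datasets of size `n`. The algorithm
is given by the law `A S` of its output on the dataset `S`; events are the measurable sets. -/
def IsDP {Z Ω : Type*} [MeasurableSpace Ω] {n : ℕ} (A : (Fin n → Z) → Measure Ω) (ε δ : ℝ) : Prop :=
  ∀ S S' : Fin n → Z, Neighboring S S' → ∀ F : Set Ω, MeasurableSet F →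
    (A S).real F ≤ Real.exp ε * (A S').real F + δ

/-- The normal distribution `N(m, v I)` on `ℝᵈ` (for a variance `v ≥ 0`). -/
def isoGaussian {d : ℕ} (m : EuclideanSpace ℝ (Fin d)) (v : ℝ) :
    Measure (EuclideanSpace ℝ (Fin d)) :=
  (stdGaussian (EuclideanSpace ℝ (Fin d))).map (fun x => m + √v • x)

instance {d : ℕ} (m : EuclideanSpace ℝ (Fin d)) (v : ℝ) : IsProbabilityMeasure (isoGaussian m v) :=
  Measure.isProbabilityMeasure_map (by fun_prop)

lemma measurable_isoGaussian {X : Type*} [MeasurableSpace X] {d : ℕ}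
    {f : X → EuclideanSpace ℝ (Fin d)} (hf : Measurable f) (v : ℝ) :
    Measurable fun x => isoGaussian (f x) v := by
  have hg : Measurable fun p : X × EuclideanSpace ℝ (Fin d) => f p.1 + √v • p.2 := by
    fun_prop
  refine Measure.measurable_of_measurable_coe _ fun s hs => ?_
  have h : (fun x => isoGaussian (f x) v s) = fun x => stdGaussian (EuclideanSpace ℝ (Fin d))
      (Prod.mk x ⁻¹' ((fun p : X × EuclideanSpace ℝ (Fin d) => f p.1 + √v • p.2) ⁻¹' s)) := by
    funext x
    rw [isoGaussian, Measure.map_apply (by fun_prop) hs, Set.preimage_preimage]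
  rw [h]
  exact measurable_measure_prodMk_left (hg hs)

lemma measurable_gradient {d : ℕ} (f : EuclideanSpace ℝ (Fin d) → ℝ) : Measurable (gradient f) :=
  (InnerProductSpace.toDual ℝ (EuclideanSpace ℝ (Fin d))).symm.continuous.measurable.comp
    (measurable_fderiv ℝ f)

/-- One noisy stochastic gradient step with batch size `1`, as a transition kernel on `ℝᵈ`: from
`w`, an index `i` is drawn uniformly from the `n` data indices, the gradient step
`w̃ = w - η ∇ℓ(w, zᵢ)` is taken, and the new point is drawn from
`N((1 - λ η) w̃, λ η (2 - λ η) β₀ I)`. The parameter `lam` is `λ`. -/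
def sgldStep {Z : Type*} {n d : ℕ} (ℓ : EuclideanSpace ℝ (Fin d) → Z → ℝ) (η lam β₀ : ℝ)
    (S : Fin n → Z) : Kernel (EuclideanSpace ℝ (Fin d)) (EuclideanSpace ℝ (Fin d)) where
  toFun w := ∑ i : Fin n, (n : ℝ≥0∞)⁻¹ •
    isoGaussian ((1 - lam * η) • (w - η • gradient (fun u => ℓ u (S i)) w))
      (lam * η * (2 - lam * η) * β₀)
  measurable' := by
    refine Measure.measurable_of_measurable_coe _ fun s hs => ?_
    simp only [Measure.coe_finsetSum, Finset.sum_apply, Measure.smul_apply, smul_eq_mul]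
    refine Finset.measurable_fun_sum _ fun i _ => Measurable.const_mul ?_ _
    exact (Measure.measurable_coe hs).comp (measurable_isoGaussian
      ((measurable_id.sub ((measurable_gradient _).const_smul η)).const_smul (1 - lam * η)) _)

instance {Z : Type*} {n d : ℕ} [NeZero n] (ℓ : EuclideanSpace ℝ (Fin d) → Z → ℝ)
    (η lam β₀ : ℝ) (S : Fin n → Z) : IsMarkovKernel (sgldStep ℓ η lam β₀ S) where
  isProbabilityMeasure w := ⟨by
    change (∑ i : Fin n, (n : ℝ≥0∞)⁻¹ • isoGaussian _ _) Set.univ = 1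
    simp [ENNReal.mul_inv_cancel (Nat.cast_ne_zero.2 (NeZero.ne n)) (ENNReal.natCast_ne_top n)]⟩

/-- Conditional law of the iterate `w_{t+1}` given the previous iterates `(w_1, …, w_t)`.
The first iterate is drawn from `N(0, β₀ I)`; the iterate `w_{s+2}` is obtained from `w_{s+1}`
(the last entry of the history) by a step with parameters `η_{s+2}` and `λ_{s+2}`. -/
def sgldNext {Z : Type*} {n d : ℕ} (ℓ : EuclideanSpace ℝ (Fin d) → Z → ℝ) (η lam : ℕ → ℝ)
    (β₀ : ℝ) (S : Fin n → Z) :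
    (t : ℕ) → Kernel (Fin t → EuclideanSpace ℝ (Fin d)) (EuclideanSpace ℝ (Fin d))
  | 0 => Kernel.const _ (isoGaussian 0 β₀)
  | s + 1 => (sgldStep ℓ (η (s + 2)) (lam (s + 2)) β₀ S).comap (fun h => h (Fin.last s))
      (measurable_pi_apply _)

instance {Z : Type*} {n d : ℕ} [NeZero n] (ℓ : EuclideanSpace ℝ (Fin d) → Z → ℝ) (η lam : ℕ → ℝ)
    (β₀ : ℝ) (S : Fin n → Z) : (t : ℕ) → IsMarkovKernel (sgldNext ℓ η lam β₀ S t)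
  | 0 => by unfold sgldNext; infer_instance
  | s + 1 => by unfold sgldNext; infer_instance

/-- Joint law of the iterates `(w_1, …, w_T)` of the noisy stochastic gradient method with batch
size `1` run on the dataset `S`; the coordinate `t : Fin T` is the iterate `w_{t+1}`. The sampled
indices and the Gaussian noises of different steps are independent. -/
def sgldLaw {Z : Type*} {n d : ℕ} (ℓ : EuclideanSpace ℝ (Fin d) → Z → ℝ) (η lam : ℕ → ℝ)
    (β₀ : ℝ) : (T : ℕ) → (Fin n → Z) → Measure (Fin T → EuclideanSpace ℝ (Fin d))
  | 0, _ => Measure.dirac Fin.elim0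
  | t + 1, S => (sgldLaw ℓ η lam β₀ t S ⊗ₘ sgldNext ℓ η lam β₀ S t).map
      fun p => Fin.snoc (α := fun _ => EuclideanSpace ℝ (Fin d)) p.1 p.2

lemma measurable_fin_snoc {X : Type*} [MeasurableSpace X] (t : ℕ) :
    Measurable fun p : (Fin t → X) × X => (Fin.snoc (α := fun _ => X) p.1 p.2 : Fin (t + 1) → X) := by
  refine measurable_pi_lambda _ fun i => ?_
  refine Fin.lastCases ?_ (fun j => ?_) i
  · simpa using measurable_snd
  · simpa [Function.comp_def] using (measurable_pi_apply (X := fun _ : Fin t => X) j).comp measurable_fst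

instance isProbabilityMeasure_sgldLaw {Z : Type*} {n d : ℕ} [NeZero n]
    (ℓ : EuclideanSpace ℝ (Fin d) → Z → ℝ) (η lam : ℕ → ℝ) (β₀ : ℝ) :
    (T : ℕ) → (S : Fin n → Z) → IsProbabilityMeasure (sgldLaw ℓ η lam β₀ T S)
  | 0, _ => by unfold sgldLaw; infer_instance
  | t + 1, S => by
    have := isProbabilityMeasure_sgldLaw ℓ η lam β₀ t S
    exact Measure.isProbabilityMeasure_map (measurable_fin_snoc t).aemeasurable

end

/-!
On neighbouring datasets, one noisy step started from the same point draws from two uniform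
mixtures of `n` Gaussians with a common covariance that differ in a single component. Their density
ratio is `1 + (A - B) / n`, where `A` and `B` are the ratios of the two versions of that component
to the mixture. After truncating `A` at `e`, the ratio `g` is at most `1 + s` for `s = e / n`, its
mean is at most `1` and its mean square distance to `1` is at most `s ^ 2`; a Bennett-type
inequality then gives `E g ^ (1 + a) ≤ exp (a s ^ 2 + (a s) ^ 2 / 2)`. The mass lost by the
truncation is governed by the divergence `E (A - e)⁺` between nearby Gaussians, and the logarithm
in `η_t` is what makes it at most `δ / (2 t ^ 2)`. Along the chain the moments multiply and the
truncation errors add up to at most `δ / 2`; Markov's inequality for the product of the ratios,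
with the optimal exponent `a`, produces `ε` and the other `δ / 2`.
-/

section ApproximateDensities

variable {X Y : Type*} [MeasurableSpace X] [MeasurableSpace Y]

/-- `f` is a sub-probability density with respect to `ν` whose `p`-th moment is at most `M`, and it
dominates `μ` up to an additive error `D`. The domination is tested on functions with values in
`[0, 1]` rather than on events, so that it can be integrated against a transition kernel. -/
structure IsApproxDensity (μ ν : Measure X) (f : X → ℝ≥0∞) (p : ℝ) (D M : ℝ≥0∞) : Prop where
  measurable : Measurable f
  lintegral_le : ∀ F : X → ℝ≥0∞, Measurable F → (∀ x, F x ≤ 1) →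
    ∫⁻ x, F x ∂μ ≤ ∫⁻ x, F x * f x ∂ν + D
  lintegral_density_le_one : ∫⁻ x, f x ∂ν ≤ 1
  lintegral_rpow_le : ∫⁻ x, f x ^ p ∂ν ≤ M

lemma lintegral_compProd_mul_le {ν : Measure X} [SFinite ν] {K : Kernel X Y} [IsSFiniteKernel K]
    {u : X → ℝ≥0∞} {v : X → Y → ℝ≥0∞} (hu : Measurable u) (hv : Measurable (Function.uncurry v))
    {A B : ℝ≥0∞} (hA : ∫⁻ x, u x ∂ν ≤ A) (hB : ∀ x, ∫⁻ y, v x y ∂(K x) ≤ B) :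
    ∫⁻ q, u q.1 * v q.1 q.2 ∂(ν ⊗ₘ K) ≤ A * B := by
  have huv : Measurable fun q : X × Y => u q.1 * v q.1 q.2 := (hu.comp measurable_fst).mul hv
  calc ∫⁻ q, u q.1 * v q.1 q.2 ∂(ν ⊗ₘ K) = ∫⁻ x, ∫⁻ y, u x * v x y ∂(K x) ∂ν :=
        Measure.lintegral_compProd huv
    _ = ∫⁻ x, u x * ∫⁻ y, v x y ∂(K x) ∂ν :=
        lintegral_congr fun x => lintegral_const_mul _ hv.of_uncurry_left
    _ ≤ ∫⁻ x, u x * B ∂ν := lintegral_mono fun x => by gcongr; exact hB x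
    _ = (∫⁻ x, u x ∂ν) * B := lintegral_mul_const _ hu
    _ ≤ A * B := by gcongr

lemma le_add_rpow_neg_mul_rpow {a : ℝ} (ha : 0 < a) {E : ℝ≥0∞} (hE0 : E ≠ 0) (hE : E ≠ ⊤)
    (x : ℝ≥0∞) : x ≤ E + E ^ (-a) * x ^ (1 + a) := by
  rcases le_total x E with hxE | hEx
  · exact le_add_right hxE
  refine le_add_left ?_
  calc x = E ^ (-a) * (E ^ a * x) := by
        rw [← mul_assoc, ← ENNReal.rpow_add _ _ hE0 hE, neg_add_cancel, ENNReal.rpow_zero, one_mul]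
    _ ≤ E ^ (-a) * (x ^ a * x) := by gcongr
    _ = E ^ (-a) * x ^ (1 + a) := by
        rw [ENNReal.rpow_add_of_nonneg _ _ zero_le_one ha.le, ENNReal.rpow_one, mul_comm x]

namespace IsApproxDensity

variable {μ ν : Measure X} {f : X → ℝ≥0∞} {p : ℝ} {D M : ℝ≥0∞}

lemma refl (μ : Measure X) [IsProbabilityMeasure μ] (p : ℝ) :
    IsApproxDensity μ μ (fun _ => 1) p 0 1 where
  measurable := measurable_const
  lintegral_le F _ _ := by simp
  lintegral_density_le_one := by simp
  lintegral_rpow_le := by simp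

lemma map (h : IsApproxDensity μ ν f p D M) {φ : X → Y} {ψ : Y → X} (hφ : Measurable φ)
    (hψ : Measurable ψ) (hψφ : Function.LeftInverse ψ φ) :
    IsApproxDensity (μ.map φ) (ν.map φ) (fun y => f (ψ y)) p D M := by
  have hf := h.measurable
  refine ⟨hf.comp hψ, fun F hF hF1 => ?_, ?_, ?_⟩
  · rw [lintegral_map hF hφ, lintegral_map (by fun_prop) hφ]
    simpa only [hψφ _] using h.lintegral_le (fun x => F (φ x)) (hF.comp hφ) fun x => hF1 (φ x)
  · rw [lintegral_map (by fun_prop) hφ]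
    simpa only [hψφ _] using h.lintegral_density_le_one
  · rw [lintegral_map (by fun_prop) hφ]
    simpa only [hψφ _] using h.lintegral_rpow_le

section CompProd

variable [SFinite ν] {K K' : Kernel X Y} [IsMarkovKernel K] [IsMarkovKernel K']
  {g : X → Y → ℝ≥0∞} {D' M' : ℝ≥0∞}

lemma lintegral_compProd_le [IsProbabilityMeasure μ] (h : IsApproxDensity μ ν f p D M)
    (hg : Measurable (Function.uncurry g))
    (hK : ∀ x, IsApproxDensity (K x) (K' x) (g x) p D' M') {F : X × Y → ℝ≥0∞} (hF : Measurable F)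
    (hF1 : ∀ q, F q ≤ 1) :
    ∫⁻ q, F q ∂(μ ⊗ₘ K) ≤ ∫⁻ q, F q * (f q.1 * g q.1 q.2) ∂(ν ⊗ₘ K') + (D + D') := by
  have hf := h.measurable
  have hfg : Measurable fun q : X × Y => F q * (f q.1 * g q.1 q.2) :=
    hF.mul ((hf.comp measurable_fst).mul hg)
  have hFg : Measurable (Function.uncurry fun x y => F (x, y) * g x y) := hF.mul hg
  have hFg1 (x : X) : ∫⁻ y, F (x, y) * g x y ∂(K' x) ≤ 1 :=
    (lintegral_mono fun y => mul_le_of_le_one_left' (hF1 _)).trans (hK x).lintegral_density_le_one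
  calc ∫⁻ q, F q ∂(μ ⊗ₘ K) = ∫⁻ x, ∫⁻ y, F (x, y) ∂(K x) ∂μ := Measure.lintegral_compProd hF
    _ ≤ ∫⁻ x, (∫⁻ y, F (x, y) * g x y ∂(K' x) + D') ∂μ :=
        lintegral_mono fun x => (hK x).lintegral_le _ (by fun_prop) fun y => hF1 _
    _ = ∫⁻ x, ∫⁻ y, F (x, y) * g x y ∂(K' x) ∂μ + D' := by
        rw [lintegral_add_right _ measurable_const, lintegral_const, measure_univ, mul_one]
    _ ≤ ∫⁻ x, (∫⁻ y, F (x, y) * g x y ∂(K' x)) * f x ∂ν + D + D' := by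
        gcongr
        exact h.lintegral_le _ hFg.lintegral_kernel_prod_right' hFg1
    _ = ∫⁻ x, ∫⁻ y, F (x, y) * (f x * g x y) ∂(K' x) ∂ν + (D + D') := by
        rw [add_assoc]
        congr 1
        refine lintegral_congr fun x => ?_
        rw [← lintegral_mul_const _ hFg.of_uncurry_left]
        exact lintegral_congr fun y => by ring
    _ = ∫⁻ q, F q * (f q.1 * g q.1 q.2) ∂(ν ⊗ₘ K') + (D + D') := by
        rw [Measure.lintegral_compProd hfg]

lemma compProd [IsProbabilityMeasure μ] (h : IsApproxDensity μ ν f p D M) (hp : 0 ≤ p)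
    (hg : Measurable (Function.uncurry g))
    (hK : ∀ x, IsApproxDensity (K x) (K' x) (g x) p D' M') :
    IsApproxDensity (μ ⊗ₘ K) (ν ⊗ₘ K') (fun q => f q.1 * g q.1 q.2) p (D + D') (M * M') where
  measurable := (h.measurable.comp measurable_fst).mul hg
  lintegral_le _ hF hF1 := h.lintegral_compProd_le hg hK hF hF1
  lintegral_density_le_one :=
    (lintegral_compProd_mul_le h.measurable hg h.lintegral_density_le_one
      fun x => (hK x).lintegral_density_le_one).trans (one_mul 1).le
  lintegral_rpow_le := by
    simp_rw [ENNReal.mul_rpow_of_nonneg _ _ hp]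
    exact lintegral_compProd_mul_le (h.measurable.pow_const p) (hg.pow_const p)
      h.lintegral_rpow_le fun x => (hK x).lintegral_rpow_le

end CompProd

section Tail

variable {a : ℝ}

lemma measure_le (h : IsApproxDensity μ ν f (1 + a) D M) (ha : 0 < a) {E : ℝ≥0∞} (hE0 : E ≠ 0)
    (hE : E ≠ ⊤) {s : Set X} (hs : MeasurableSet s) :
    μ s ≤ E * ν s + (E ^ (-a) * M + D) := by
  have hf := h.measurable
  have hμ : μ s ≤ ∫⁻ x in s, f x ∂ν + D := by
    simpa [← Set.indicator_mul_left, lintegral_indicator hs] using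
      h.lintegral_le (s.indicator 1) (measurable_one.indicator hs)
        (Set.indicator_le_self' (by simp) ·)
  calc μ s ≤ ∫⁻ x in s, (E + E ^ (-a) * f x ^ (1 + a)) ∂ν + D :=
        hμ.trans (by gcongr; exact le_add_rpow_neg_mul_rpow ha hE0 hE _)
    _ = E * ν s + (E ^ (-a) * ∫⁻ x in s, f x ^ (1 + a) ∂ν + D) := by
        rw [lintegral_add_left measurable_const, setLIntegral_const,
          lintegral_const_mul _ (by fun_prop), add_assoc]
    _ ≤ E * ν s + (E ^ (-a) * M + D) := by
        gcongr
        exact (setLIntegral_le_lintegral _ _).trans h.lintegral_rpow_le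

lemma measureReal_le {D M : ℝ} [IsFiniteMeasure ν]
    (h : IsApproxDensity μ ν f (1 + a) (ENNReal.ofReal D) (ENNReal.ofReal M)) (ha : 0 < a)
    (hD : 0 ≤ D) (hM : 0 ≤ M) (ε : ℝ) {s : Set X} (hs : MeasurableSet s) :
    μ.real s ≤ Real.exp ε * ν.real s + (Real.exp (-a * ε) * M + D) := by
  have hε := Real.exp_pos ε
  have hexp : ENNReal.ofReal (Real.exp ε) ^ (-a) = ENNReal.ofReal (Real.exp (-a * ε)) := by
    rw [ENNReal.ofReal_rpow_of_pos hε, ← Real.exp_mul, mul_comm]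
  have hle := h.measure_le ha (ENNReal.ofReal_pos.2 hε).ne' ENNReal.ofReal_ne_top hs
  rw [hexp, ← ofReal_measureReal (μ := ν), ← ENNReal.ofReal_mul hε.le,
    ← ENNReal.ofReal_mul (Real.exp_pos _).le, ← ENNReal.ofReal_add (by positivity) hD,
    ← ENNReal.ofReal_add (by positivity) (by positivity)] at hle
  exact ENNReal.toReal_le_of_le_ofReal (by positivity) hle

end Tail

end IsApproxDensity

end ApproximateDensities

section MomentBound

open Real

lemma hasSum_exp_sub_one_sub (x : ℝ) :
    HasSum (fun k : ℕ => x ^ (k + 2) / (k + 2).factorial) (exp x - 1 - x) := by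
  have h : HasSum (fun k : ℕ => x ^ k / k.factorial) (exp x) := by
    rw [exp_eq_exp_ℝ]
    exact NormedSpace.expSeries_div_hasSum_exp x
  simpa [Finset.sum_range_succ, sub_sub] using (hasSum_nat_add_iff' 2).2 h

lemma exp_le_one_add_add_sq_half {y : ℝ} (hy : y ≤ 0) : exp y ≤ 1 + y + y ^ 2 / 2 := by
  have hneg : 1 - y + y ^ 2 / 2 ≤ exp (-y) := by
    simpa [sub_eq_add_neg] using quadratic_le_exp_of_nonneg (neg_nonneg.2 hy)
  have hpos : 0 < 1 + y + y ^ 2 / 2 := by nlinarith [sq_nonneg (y + 1)]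
  calc exp y = 1 / exp (-y) := by rw [exp_neg, one_div, inv_inv]
    _ ≤ 1 + y + y ^ 2 / 2 := by
        rw [div_le_iff₀ (exp_pos _)]
        nlinarith [mul_le_mul_of_nonneg_left hneg hpos.le, sq_nonneg (y ^ 2)]

lemma exp_le_one_add_add_sq_mul {y b : ℝ} (hb : 0 < b) (hy : y ≤ b) :
    exp y ≤ 1 + y + y ^ 2 * ((exp b - 1 - b) / b ^ 2) := by
  rcases le_total y 0 with hy0 | hy0
  · have hhalf : 1 / 2 ≤ (exp b - 1 - b) / b ^ 2 := by
      rw [le_div_iff₀ (by positivity)]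
      linarith [quadratic_le_exp_of_nonneg hb.le]
    linarith [exp_le_one_add_add_sq_half hy0, mul_le_mul_of_nonneg_left hhalf (sq_nonneg y)]
  · have hterm (k : ℕ) : y ^ (k + 2) / (k + 2).factorial ≤
        y ^ 2 / b ^ 2 * (b ^ (k + 2) / (k + 2).factorial) :=
      calc y ^ (k + 2) / (k + 2).factorial = y ^ 2 * y ^ k / (k + 2).factorial := by ring
        _ ≤ y ^ 2 * b ^ k / (k + 2).factorial := by gcongr
        _ = y ^ 2 / b ^ 2 * (b ^ (k + 2) / (k + 2).factorial) := by field_simp; ring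
    have hsum := hasSum_le hterm (hasSum_exp_sub_one_sub y)
      ((hasSum_exp_sub_one_sub b).mul_left (y ^ 2 / b ^ 2))
    rw [div_mul_eq_mul_div, mul_div_assoc] at hsum
    linarith

/- The quadratic on the right interpolates `exp` at `±θ`, with a double node at `-θ`. Unlike the
Taylor-type bound `exp_le_one_add_add_sq_mul`, whose mean would be of size `exp θ - θ`, it gives the
sub-Gaussian `cosh θ ≤ exp (θ ^ 2 / 2)` for a centred variable of variance `θ ^ 2`. -/
lemma exists_exp_le_quadratic {θ : ℝ} (hθ : 0 < θ) :
    ∃ c, 0 ≤ c ∧ ∀ y ≤ θ, exp y ≤ cosh θ + sinh θ / θ * y + c * (y ^ 2 - θ ^ 2) := by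
  refine ⟨(sinh θ - θ * exp (-θ)) / (2 * θ ^ 2), ?_, fun y hy => ?_⟩
  · have hle : θ * exp (-θ) ≤ θ := mul_le_of_le_one_right hθ.le (exp_le_one_iff.2 (by linarith))
    exact div_nonneg (by linarith [self_le_sinh_iff.2 hθ.le]) (by positivity)
  · have hexp : exp (2 * θ) = exp θ ^ 2 := by rw [← exp_nat_mul]; norm_num
    calc exp y = exp (-θ) * exp (y + θ) := by rw [← exp_add]; ring_nf
      _ ≤ exp (-θ) * (1 + (y + θ) + (y + θ) ^ 2 * ((exp (2 * θ) - 1 - 2 * θ) / (2 * θ) ^ 2)) := by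
          gcongr
          exact exp_le_one_add_add_sq_mul (by positivity) (by linarith)
      _ = _ := by
          rw [hexp, cosh_eq, sinh_eq, exp_neg]
          field_simp
          ring

lemma mul_log_sq_le {x : ℝ} (hx : 0 < x) : x * log x ^ 2 ≤ (x - 1) ^ 2 := by
  obtain ⟨w, rfl⟩ : ∃ w, x = exp (2 * w) :=
    ⟨log x / 2, by rw [mul_div_cancel₀ _ two_ne_zero, exp_log hx]⟩
  have hsq : exp (2 * w) = exp w ^ 2 := by rw [← exp_nat_mul]; norm_num
  have hsub : exp (2 * w) - 1 = exp w * (2 * sinh w) := by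
    rw [hsq, sinh_eq, exp_neg]
    have := exp_pos w
    field_simp
  have hw : w ^ 2 ≤ sinh w ^ 2 := by
    rw [sq_le_sq, abs_sinh]
    exact self_le_sinh_iff.2 (abs_nonneg w)
  calc exp (2 * w) * log (exp (2 * w)) ^ 2 = exp w ^ 2 * 4 * w ^ 2 := by rw [log_exp, hsq]; ring
    _ ≤ exp w ^ 2 * 4 * sinh w ^ 2 := by gcongr
    _ = (exp (2 * w) - 1) ^ 2 := by rw [hsub]; ring

lemma exists_rpow_one_add_le_quadratic {s a : ℝ} (hs : 0 < s) (ha : 0 < a) :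
    ∃ α β, 0 ≤ α ∧ 0 ≤ β ∧ ∀ x, 0 ≤ x → x ≤ 1 + s → x ^ (1 + a) ≤
      cosh (a * s) + s * sinh (a * s) + α * (x - 1) + β * ((x - 1) ^ 2 - s ^ 2) := by
  have hθ : 0 < a * s := by positivity
  obtain ⟨c, hc, hquad⟩ := exists_exp_le_quadratic hθ
  set θ := a * s with hθs
  have : 0 ≤ sinh θ := sinh_nonneg_iff.2 hθ.le
  have hα : 0 ≤ cosh θ - c * θ ^ 2 := by
    have := hquad 0 hθ.le
    rw [exp_zero] at this
    linarith
  refine ⟨cosh θ - c * θ ^ 2 + sinh θ / s, sinh θ / s + c * a ^ 2, by positivity, by positivity,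
    fun x hx0 hxs => ?_⟩
  have hexpand : cosh θ + s * sinh θ + (cosh θ - c * θ ^ 2 + sinh θ / s) * (x - 1) +
      (sinh θ / s + c * a ^ 2) * ((x - 1) ^ 2 - s ^ 2) =
      (cosh θ - c * θ ^ 2) * x + sinh θ / s * (x * (x - 1)) + c * a ^ 2 * (x - 1) ^ 2 := by
    rw [hθs]
    field_simp
    ring
  rw [hexpand]
  rcases hx0.eq_or_lt with rfl | hx
  · rw [zero_rpow (by positivity)]
    nlinarith [mul_nonneg hc (sq_nonneg a)]
  have hlog : log x ≤ x - 1 := log_le_sub_one_of_pos hx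
  calc x ^ (1 + a) = x * exp (a * log x) := by
        rw [rpow_add hx, rpow_one, rpow_def_of_pos hx, mul_comm a]
    _ ≤ x * (cosh θ + sinh θ / θ * (a * log x) + c * ((a * log x) ^ 2 - θ ^ 2)) := by
        gcongr
        exact hquad _ (mul_le_mul_of_nonneg_left (by linarith) ha.le)
    _ = (cosh θ - c * θ ^ 2) * x + sinh θ / s * (x * log x) + c * a ^ 2 * (x * log x ^ 2) := by
        rw [hθs]
        field_simp
        ring
    _ ≤ (cosh θ - c * θ ^ 2) * x + sinh θ / s * (x * (x - 1)) + c * a ^ 2 * (x - 1) ^ 2 := by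
        gcongr
        exact mul_log_sq_le hx

lemma sinh_le_mul_cosh {x : ℝ} (hx : 0 ≤ x) : sinh x ≤ x * cosh x := by
  have hderiv (y : ℝ) : HasDerivAt (fun y => y * cosh y - sinh y) (y * sinh y) y := by
    refine (((hasDerivAt_id' y).fun_mul (hasDerivAt_cosh y)).fun_sub
      (hasDerivAt_sinh y)).congr_deriv ?_
    ring
  have hmono : MonotoneOn (fun y => y * cosh y - sinh y) (Set.Ici 0) := by
    refine monotoneOn_of_deriv_nonneg (convex_Ici 0) (by fun_prop) (by fun_prop) fun y hy => ?_
    rw [interior_Ici] at hy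
    rw [(hderiv y).deriv]
    exact mul_nonneg hy.le (sinh_nonneg_iff.2 hy.le)
  simpa using hmono (Set.mem_Ici.2 le_rfl) (Set.mem_Ici.2 hx) hx

lemma cosh_add_mul_sinh_le {s θ : ℝ} (hs : 0 ≤ s) (hθ : 0 ≤ θ) :
    cosh θ + s * sinh θ ≤ exp (θ * s + θ ^ 2 / 2) :=
  calc cosh θ + s * sinh θ ≤ cosh θ + s * (θ * cosh θ) := by gcongr; exact sinh_le_mul_cosh hθ
    _ = (θ * s + 1) * cosh θ := by ring
    _ ≤ exp (θ * s) * exp (θ ^ 2 / 2) := by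
        gcongr
        · exact add_one_le_exp _
        · exact cosh_le_exp_half_sq θ
    _ = exp (θ * s + θ ^ 2 / 2) := (exp_add _ _).symm

lemma integral_rpow_one_add_le {X : Type*} [MeasurableSpace X] {Q : Measure X}
    [IsProbabilityMeasure Q] {g : X → ℝ} {s a : ℝ} (hs : 0 < s) (ha : 0 < a) (hg : Measurable g)
    (hg0 : ∀ x, 0 ≤ g x) (hgs : ∀ x, g x ≤ 1 + s) (hmean : ∫ x, g x ∂Q ≤ 1)
    (hvar : ∫ x, (g x - 1) ^ 2 ∂Q ≤ s ^ 2) :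
    ∫ x, g x ^ (1 + a) ∂Q ≤ exp (a * s * s + (a * s) ^ 2 / 2) := by
  obtain ⟨α, β, hα, hβ, hquad⟩ := exists_rpow_one_add_le_quadratic hs ha
  have hgLp : MemLp g ⊤ Q := MemLp.of_bound hg.aestronglyMeasurable (1 + s)
    (.of_forall fun x => by rw [norm_of_nonneg (hg0 x)]; exact hgs x)
  have hint : Integrable (fun x => g x - 1) Q :=
    (hgLp.integrable le_top).sub (integrable_const _)
  have hint2 : Integrable (fun x => (g x - 1) ^ 2) Q :=
    ((hgLp.sub (memLp_const 1)).mono_exponent le_top).integrable_sq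
  set κ := cosh (a * s) + s * sinh (a * s)
  calc ∫ x, g x ^ (1 + a) ∂Q
      ≤ ∫ x, (κ + α * (g x - 1) + β * ((g x - 1) ^ 2 - s ^ 2)) ∂Q := by
        refine integral_mono_of_nonneg (.of_forall fun x => rpow_nonneg (hg0 x) _) ?_
          (.of_forall fun x => hquad _ (hg0 x) (hgs x))
        fun_prop
    _ = κ + α * (∫ x, g x ∂Q - 1) + β * (∫ x, (g x - 1) ^ 2 ∂Q - s ^ 2) := by
        rw [integral_add (by fun_prop) (by fun_prop), integral_add (by fun_prop) (by fun_prop),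
          integral_const_mul, integral_const_mul, integral_sub (hgLp.integrable le_top)
            (by fun_prop), integral_sub hint2 (by fun_prop)]
        simp
    _ ≤ κ := by nlinarith
    _ ≤ exp (a * s * s + (a * s) ^ 2 / 2) := cosh_add_mul_sinh_le hs.le (by positivity)

end MomentBound

section Truncation

variable {X : Type*} [MeasurableSpace X] {Q : Measure X} {A B : X → ℝ} {N a c : ℝ}

lemma integral_le_of_lintegral_ofReal_le {f : X → ℝ} {V : ℝ} (hf : Measurable f)
    (hf0 : ∀ x, 0 ≤ f x) (hV : 0 ≤ V)
    (h : ∫⁻ x, ENNReal.ofReal (f x) ∂Q ≤ ENNReal.ofReal V) : ∫ x, f x ∂Q ≤ V := by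
  rw [integral_eq_lintegral_of_nonneg_ae (.of_forall hf0) hf.aestronglyMeasurable]
  exact ENNReal.toReal_le_of_le_ofReal hV h

lemma integrable_of_lintegral_ofReal_le {f : X → ℝ} {V : ℝ} (hf : Measurable f)
    (hf0 : ∀ x, 0 ≤ f x) (h : ∫⁻ x, ENNReal.ofReal (f x) ∂Q ≤ ENNReal.ofReal V) :
    Integrable f Q :=
  ⟨hf.aestronglyMeasurable, (hasFiniteIntegral_iff_ofReal (.of_forall hf0)).2
    (h.trans_lt ENNReal.ofReal_lt_top)⟩

lemma lintegral_ofReal_eq_ofReal_integral_of_bounded [IsFiniteMeasure Q] {f : X → ℝ} {K : ℝ}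
    (hf : Measurable f) (hf0 : ∀ x, 0 ≤ f x) (hfK : ∀ x, f x ≤ K) :
    ∫⁻ x, ENNReal.ofReal (f x) ∂Q = ENNReal.ofReal (∫ x, f x ∂Q) :=
  (ofReal_integral_eq_lintegral_ofReal (Integrable.of_bound hf.aestronglyMeasurable K
    (.of_forall fun x => by rw [Real.norm_of_nonneg (hf0 x)]; exact hfK x)) (.of_forall hf0)).symm

lemma one_add_min_sub_div_nonneg {A B N c : ℝ} (hN : 0 < N) (hA : 0 ≤ A) (hc : 0 ≤ c)
    (hB : B ≤ N) : 0 ≤ 1 + (min A c - B) / N := by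
  have : -1 ≤ (min A c - B) / N := by
    rw [le_div_iff₀ hN]
    linarith [le_min hA hc]
  linarith

lemma integral_one_add_min_sub_div_le [IsProbabilityMeasure Q] (hN : 0 < N)
    (hA : Integrable A Q) (hB : Integrable B Q) (hAB : ∫ x, A x ∂Q ≤ ∫ x, B x ∂Q) :
    ∫ x, (1 + (min (A x) c - B x) / N) ∂Q ≤ 1 := by
  have hmin : Integrable (fun x => min (A x) c) Q := hA.inf (integrable_const c)
  have hle : ∫ x, min (A x) c ∂Q ≤ ∫ x, A x ∂Q := integral_mono hmin hA fun x => min_le_left _ _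
  have hdiff : Integrable (fun x => (min (A x) c - B x) / N) Q := (hmin.sub hB).div_const N
  rw [integral_add (integrable_const _) hdiff, integral_div, integral_sub hmin hB]
  simpa using div_nonpos_of_nonpos_of_nonneg (by linarith) hN.le

lemma integral_sq_min_sub_div_le (hA : Measurable A) (hB : Measurable B) (hA0 : ∀ x, 0 ≤ A x)
    (hB0 : ∀ x, 0 ≤ B x) (hc : 0 ≤ c)
    (hA2 : ∫⁻ x, ENNReal.ofReal (A x ^ 2) ∂Q ≤ ENNReal.ofReal (c ^ 2 / 2))
    (hB2 : ∫⁻ x, ENNReal.ofReal (B x ^ 2) ∂Q ≤ ENNReal.ofReal (c ^ 2 / 2)) :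
    ∫ x, (1 + (min (A x) c - B x) / N - 1) ^ 2 ∂Q ≤ (c / N) ^ 2 := by
  have hiA := integrable_of_lintegral_ofReal_le (hA.pow_const 2) (fun x => sq_nonneg _) hA2
  have hiB := integrable_of_lintegral_ofReal_le (hB.pow_const 2) (fun x => sq_nonneg _) hB2
  have hpt (x : X) : (1 + (min (A x) c - B x) / N - 1) ^ 2 ≤ (A x ^ 2 + B x ^ 2) / N ^ 2 := by
    rw [add_sub_cancel_left, div_pow]
    gcongr
    have hmin0 : 0 ≤ min (A x) c := le_min (hA0 x) hc
    nlinarith [mul_nonneg hmin0 (hB0 x), min_le_left (A x) c]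
  calc ∫ x, (1 + (min (A x) c - B x) / N - 1) ^ 2 ∂Q ≤ ∫ x, (A x ^ 2 + B x ^ 2) / N ^ 2 ∂Q :=
        integral_mono_of_nonneg (.of_forall fun x => sq_nonneg _) ((hiA.add hiB).div_const _)
          (.of_forall hpt)
    _ = (∫ x, A x ^ 2 ∂Q + ∫ x, B x ^ 2 ∂Q) / N ^ 2 := by
        rw [integral_div, integral_add hiA hiB]
    _ ≤ (c ^ 2 / 2 + c ^ 2 / 2) / N ^ 2 := by
        gcongr <;>
        exact integral_le_of_lintegral_ofReal_le (by fun_prop) (fun x => sq_nonneg _)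
          (by positivity) ‹_›
    _ = (c / N) ^ 2 := by rw [add_halves, div_pow]

lemma lintegral_withDensity_le_of_truncation {F : X → ℝ≥0∞} {D : ℝ} (hF : Measurable F)
    (hF1 : ∀ x, F x ≤ 1) (hA : Measurable A) (hB : Measurable B) (hN : 0 < N)
    (hD : ∫⁻ x, ENNReal.ofReal (A x - c) ∂Q ≤ ENNReal.ofReal D) :
    ∫⁻ x, F x ∂(Q.withDensity fun x => ENNReal.ofReal (1 + (A x - B x) / N)) ≤
      ∫⁻ x, F x * ENNReal.ofReal (1 + (min (A x) c - B x) / N) ∂Q + ENNReal.ofReal (D / N) := by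
  have hsplit (x : X) : ENNReal.ofReal (1 + (A x - B x) / N) ≤
      ENNReal.ofReal (1 + (min (A x) c - B x) / N) + ENNReal.ofReal (A x - c) / ENNReal.ofReal N :=
    calc ENNReal.ofReal (1 + (A x - B x) / N)
        ≤ ENNReal.ofReal (1 + (min (A x) c - B x) / N + max (A x - c) 0 / N) := by
          refine ENNReal.ofReal_le_ofReal ?_
          have hmax : A x - min (A x) c ≤ max (A x - c) 0 := by
            rcases min_cases (A x) c with h | h <;> simp [h.1]
          have := div_le_div_of_nonneg_right hmax hN.le
          simp only [sub_div] at this ⊢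
          linarith
      _ ≤ _ := by
          refine ENNReal.ofReal_add_le.trans_eq ?_
          rw [ENNReal.ofReal_div_of_pos hN, ENNReal.ofReal_max, ENNReal.ofReal_zero,
            max_eq_left zero_le]
  calc ∫⁻ x, F x ∂(Q.withDensity fun x => ENNReal.ofReal (1 + (A x - B x) / N))
      = ∫⁻ x, ENNReal.ofReal (1 + (A x - B x) / N) * F x ∂Q :=
        lintegral_withDensity_eq_lintegral_mul _ (by fun_prop) hF
    _ ≤ ∫⁻ x, (F x * ENNReal.ofReal (1 + (min (A x) c - B x) / N) +
          ENNReal.ofReal (A x - c) / ENNReal.ofReal N) ∂Q := by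
        refine lintegral_mono fun x => ?_
        calc _ ≤ _ := mul_le_mul_left (hsplit x) (F x)
          _ ≤ _ := by
            rw [add_mul, mul_comm (F x)]
            gcongr
            exact mul_le_of_le_one_right' (hF1 x)
    _ ≤ ∫⁻ x, F x * ENNReal.ofReal (1 + (min (A x) c - B x) / N) ∂Q + ENNReal.ofReal (D / N) := by
        rw [lintegral_add_right _ (by fun_prop), ENNReal.ofReal_div_of_pos hN]
        simp_rw [div_eq_mul_inv]
        rw [lintegral_mul_const _ (by fun_prop)]
        gcongr

theorem isApproxDensity_of_truncation [IsProbabilityMeasure Q] {D : ℝ} (hA : Measurable A)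
    (hB : Measurable B) (hA0 : ∀ x, 0 ≤ A x) (hB0 : ∀ x, 0 ≤ B x) (hBN : ∀ x, B x ≤ N)
    (hN : 0 < N) (ha : 0 < a) (hc : 0 < c) (hAi : Integrable A Q)
    (hAB : ∫ x, A x ∂Q ≤ ∫ x, B x ∂Q)
    (hA2 : ∫⁻ x, ENNReal.ofReal (A x ^ 2) ∂Q ≤ ENNReal.ofReal (c ^ 2 / 2))
    (hB2 : ∫⁻ x, ENNReal.ofReal (B x ^ 2) ∂Q ≤ ENNReal.ofReal (c ^ 2 / 2))
    (hD : ∫⁻ x, ENNReal.ofReal (A x - c) ∂Q ≤ ENNReal.ofReal D) :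
    IsApproxDensity (Q.withDensity fun x => ENNReal.ofReal (1 + (A x - B x) / N)) Q
      (fun x => ENNReal.ofReal (1 + (min (A x) c - B x) / N)) (1 + a) (ENNReal.ofReal (D / N))
      (ENNReal.ofReal (Real.exp (a * (c / N) * (c / N) + (a * (c / N)) ^ 2 / 2))) := by
  set g : X → ℝ := fun x => 1 + (min (A x) c - B x) / N
  have hg : Measurable g := by fun_prop
  have hg0 (x : X) : 0 ≤ g x := one_add_min_sub_div_nonneg hN (hA0 x) hc.le (hBN x)
  have hgc (x : X) : g x ≤ 1 + c / N := by
    simp only [g]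
    gcongr
    linarith [min_le_right (A x) c, hB0 x]
  have hBi : Integrable B Q := Integrable.of_bound hB.aestronglyMeasurable N
    (.of_forall fun x => by rw [Real.norm_of_nonneg (hB0 x)]; exact hBN x)
  have hmean : ∫ x, g x ∂Q ≤ 1 := integral_one_add_min_sub_div_le hN hAi hBi hAB
  refine ⟨by fun_prop, fun F hF hF1 => ?_, ?_, ?_⟩
  · exact lintegral_withDensity_le_of_truncation hF hF1 hA hB hN hD
  · rw [lintegral_ofReal_eq_ofReal_integral_of_bounded hg hg0 hgc]
    exact ENNReal.ofReal_le_one.2 hmean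
  · calc ∫⁻ x, ENNReal.ofReal (g x) ^ (1 + a) ∂Q
        = ∫⁻ x, ENNReal.ofReal (g x ^ (1 + a)) ∂Q :=
          lintegral_congr fun x => ENNReal.ofReal_rpow_of_nonneg (hg0 x) (by positivity)
      _ = ENNReal.ofReal (∫ x, g x ^ (1 + a) ∂Q) :=
          lintegral_ofReal_eq_ofReal_integral_of_bounded (hg.pow_const _)
            (fun x => Real.rpow_nonneg (hg0 x) _)
            fun x => Real.rpow_le_rpow (hg0 x) (hgc x) (by positivity)
      _ ≤ _ := ENNReal.ofReal_le_ofReal (integral_rpow_one_add_le (by positivity) ha hg hg0 hgc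
          hmean (integral_sq_min_sub_div_le hA hB hA0 hB0 hc.le hA2 hB2))

end Truncation

section Mixtures

variable {ι X : Type*} [Fintype ι]

/-- The pointwise mean of the finite family `p`, which is the density of the uniform mixture of the
measures with densities `p i`. -/
noncomputable def averageDensity (p : ι → X → ℝ) (x : X) : ℝ :=
  (∑ i, p i x) / Fintype.card ι

section Pointwise

variable [Nonempty ι] {p p' : ι → X → ℝ}

lemma averageDensity_pos (hp : ∀ i x, 0 < p i x) (x : X) : 0 < averageDensity p x :=
  div_pos (Finset.sum_pos (fun i _ => hp i x) Finset.univ_nonempty) (by simp [Fintype.card_pos])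

lemma div_averageDensity_le_card (hp : ∀ i x, 0 < p i x) (j : ι) (x : X) :
    p j x / averageDensity p x ≤ Fintype.card ι := by
  rw [div_le_iff₀ (averageDensity_pos hp x), averageDensity, mul_div_cancel₀ _ (by simp)]
  exact Finset.single_le_sum (f := fun i => p i x) (fun i _ => (hp i x).le) (Finset.mem_univ j)

lemma averageDensity_div_averageDensity (hp' : ∀ i x, 0 < p' i x) {j : ι}
    (hj : ∀ i, i ≠ j → p i = p' i) (x : X) :
    averageDensity p x / averageDensity p' x = 1 + (p j x / averageDensity p' x -
      p' j x / averageDensity p' x) / Fintype.card ι := by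
  have hq := averageDensity_pos hp' x
  have hsum : ∑ i, p i x - ∑ i, p' i x = p j x - p' j x := by
    rw [← Finset.sum_sub_distrib]
    exact Finset.sum_eq_single j (fun i _ hi => by rw [hj i hi, sub_self]) (by simp)
  have hdiff : averageDensity p x = averageDensity p' x + (p j x - p' j x) / Fintype.card ι := by
    rw [averageDensity, averageDensity, ← hsum]
    ring
  rw [hdiff]
  field_simp

/-- Jensen's inequality for the weights `p i x / ∑ k, p k x`. -/
lemma averageDensity_mul_le_of_convexOn (hp : ∀ i x, 0 < p i x) {φ : ℝ → ℝ}
    (hφ : ConvexOn ℝ (Set.Ici 0) φ) {b : ℝ} (hb : 0 ≤ b) (x : X) :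
    averageDensity p x * φ (b / averageDensity p x) ≤
      averageDensity (fun i x => p i x * φ (b / p i x)) x := by
  have hS : 0 < ∑ i, p i x := Finset.sum_pos (fun i _ => hp i x) Finset.univ_nonempty
  have hmean : ∑ i, p i x / (∑ k, p k x) * (b / p i x) = b / averageDensity p x :=
    calc ∑ i, p i x / (∑ k, p k x) * (b / p i x) = ∑ _i : ι, b / ∑ k, p k x :=
          Finset.sum_congr rfl fun i _ => by
            have := (hp i x).ne'
            field_simp
      _ = b / averageDensity p x := by
          rw [Finset.sum_const, Finset.card_univ, nsmul_eq_mul, averageDensity]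
          field_simp
  have hJensen := hφ.map_sum_le (t := Finset.univ) (w := fun i => p i x / ∑ k, p k x)
    (p := fun i => b / p i x) (fun i _ => div_nonneg (hp i x).le hS.le)
    (by rw [← Finset.sum_div, div_self hS.ne']) (fun i _ => div_nonneg hb (hp i x).le)
  simp only [smul_eq_mul] at hJensen
  rw [hmean] at hJensen
  calc averageDensity p x * φ (b / averageDensity p x)
      ≤ averageDensity p x * ∑ i, p i x / (∑ k, p k x) * φ (b / p i x) := by
        gcongr
        exact (averageDensity_pos hp x).le
    _ = averageDensity (fun i x => p i x * φ (b / p i x)) x := by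
        simp_rw [averageDensity, div_mul_eq_mul_div _ (∑ k, p k x), ← Finset.sum_div]
        field_simp

lemma ofReal_averageDensity_le (p : ι → X → ℝ) (x : X) :
    ENNReal.ofReal (averageDensity p x) ≤
      ∑ i, (Fintype.card ι : ℝ≥0∞)⁻¹ * ENNReal.ofReal (p i x) := by
  rw [averageDensity, ENNReal.ofReal_div_of_pos (by simp [Fintype.card_pos]),
    ENNReal.ofReal_natCast, ENNReal.div_eq_inv_mul, ← Finset.mul_sum]
  gcongr
  exact Finset.le_sum_of_subadditive _ ENNReal.ofReal_zero.le (fun _ _ => ENNReal.ofReal_add_le) _ _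

end Pointwise

variable [MeasurableSpace X] {ρ : Measure X} {p p' : ι → X → ℝ} {a c : ℝ}

/-- The mixture of the finite family `P` with equal weights. -/
noncomputable def uniformMixture (P : ι → Measure X) : Measure X :=
  ∑ i, (Fintype.card ι : ℝ≥0∞)⁻¹ • P i

instance [Nonempty ι] (P : ι → Measure X) [∀ i, IsProbabilityMeasure (P i)] :
    IsProbabilityMeasure (uniformMixture P) :=
  ⟨by simp [uniformMixture, ENNReal.mul_inv_cancel]⟩

@[fun_prop]
lemma measurable_averageDensity (hp : ∀ i, Measurable (p i)) : Measurable (averageDensity p) :=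
  (Finset.measurable_fun_sum _ fun i _ => hp i).div_const _

lemma withDensity_averageDensity [Nonempty ι] (hp : ∀ i, Measurable (p i))
    (hp0 : ∀ i x, 0 ≤ p i x) :
    ρ.withDensity (fun x => ENNReal.ofReal (averageDensity p x)) =
      uniformMixture fun i => ρ.withDensity fun x => ENNReal.ofReal (p i x) := by
  have hdensity (x : X) : ENNReal.ofReal (averageDensity p x) =
      ∑ i, (Fintype.card ι : ℝ≥0∞)⁻¹ * ENNReal.ofReal (p i x) := by
    rw [averageDensity, ENNReal.ofReal_div_of_pos (by simp [Fintype.card_pos]),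
      ENNReal.ofReal_natCast, ENNReal.div_eq_inv_mul, ← Finset.mul_sum,
      ENNReal.ofReal_sum_of_nonneg fun i _ => hp0 i x]
  ext s hs
  rw [withDensity_apply _ hs, lintegral_congr hdensity,
    lintegral_finsetSum _ fun i _ => by fun_prop, uniformMixture, Measure.finsetSum_apply]
  refine Finset.sum_congr rfl fun i _ => ?_
  rw [lintegral_const_mul _ (by fun_prop), Measure.smul_apply, withDensity_apply _ hs, smul_eq_mul]

/-- Convexity of `f`-divergences in the second argument: the divergence to a mixture is at most the
largest divergence to one of its components. -/
lemma lintegral_ofReal_div_averageDensity_le [Nonempty ι] (hp : ∀ i, Measurable (p i))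
    (hp0 : ∀ i x, 0 < p i x) {φ : ℝ → ℝ} (hφ : ConvexOn ℝ (Set.Ici 0) φ) (hφm : Measurable φ)
    {f : X → ℝ} (hf : Measurable f) (hf0 : ∀ x, 0 ≤ f x) {V : ℝ≥0∞}
    (hV : ∀ i, ∫⁻ x, ENNReal.ofReal (φ (f x / p i x))
      ∂(ρ.withDensity fun x => ENNReal.ofReal (p i x)) ≤ V) :
    ∫⁻ x, ENNReal.ofReal (φ (f x / averageDensity p x))
      ∂(ρ.withDensity fun x => ENNReal.ofReal (averageDensity p x)) ≤ V := by
  have hwd {q : X → ℝ} (hq : Measurable q) (hq0 : ∀ x, 0 < q x) :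
      ∫⁻ x, ENNReal.ofReal (φ (f x / q x)) ∂(ρ.withDensity fun x => ENNReal.ofReal (q x)) =
        ∫⁻ x, ENNReal.ofReal (q x * φ (f x / q x)) ∂ρ := by
    rw [lintegral_withDensity_eq_lintegral_mul _ (by fun_prop) (by fun_prop)]
    exact lintegral_congr fun x => (ENNReal.ofReal_mul (hq0 x).le).symm
  rw [hwd (by fun_prop) (averageDensity_pos hp0)]
  calc ∫⁻ x, ENNReal.ofReal (averageDensity p x * φ (f x / averageDensity p x)) ∂ρ
      ≤ ∫⁻ x, ∑ i, (Fintype.card ι : ℝ≥0∞)⁻¹ * ENNReal.ofReal (p i x * φ (f x / p i x)) ∂ρ :=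
        lintegral_mono fun x => (ENNReal.ofReal_le_ofReal
          (averageDensity_mul_le_of_convexOn hp0 hφ (hf0 x) x)).trans
          (ofReal_averageDensity_le (fun i y => p i y * φ (f x / p i y)) x)
    _ = ∑ i, (Fintype.card ι : ℝ≥0∞)⁻¹ * ∫⁻ x, ENNReal.ofReal (φ (f x / p i x))
          ∂(ρ.withDensity fun x => ENNReal.ofReal (p i x)) := by
        rw [lintegral_finsetSum _ fun i _ => by fun_prop]
        refine Finset.sum_congr rfl fun i _ => ?_
        rw [lintegral_const_mul _ (by fun_prop), hwd (hp i) (hp0 i)]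
    _ ≤ ∑ _i : ι, (Fintype.card ι : ℝ≥0∞)⁻¹ * V := by gcongr with i; exact hV i
    _ = V := by simp [← mul_assoc, ENNReal.mul_inv_cancel]

section Ratio

variable {p q : X → ℝ}

lemma withDensity_ofReal_withDensity_div (hp : Measurable p) (hq : Measurable q)
    (hq0 : ∀ x, 0 < q x) :
    (ρ.withDensity fun x => ENNReal.ofReal (q x)).withDensity
      (fun x => ENNReal.ofReal (p x / q x)) = ρ.withDensity fun x => ENNReal.ofReal (p x) := by
  rw [← withDensity_mul _ (by fun_prop) (by fun_prop)]
  congr 1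
  ext x
  rw [Pi.mul_apply, ← ENNReal.ofReal_mul (hq0 x).le, mul_div_cancel₀ _ (hq0 x).ne']

lemma lintegral_ofReal_div_withDensity (hp : Measurable p) (hq : Measurable q)
    (hq0 : ∀ x, 0 < q x) :
    ∫⁻ x, ENNReal.ofReal (p x / q x) ∂(ρ.withDensity fun x => ENNReal.ofReal (q x)) =
      (ρ.withDensity fun x => ENNReal.ofReal (p x)) Set.univ := by
  rw [← withDensity_ofReal_withDensity_div hp hq hq0, withDensity_apply _ .univ,
    Measure.restrict_univ]

lemma integrable_div_withDensity (hp : Measurable p) (hp0 : ∀ x, 0 ≤ p x) (hq : Measurable q)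
    (hq0 : ∀ x, 0 < q x) [IsFiniteMeasure (ρ.withDensity fun x => ENNReal.ofReal (p x))] :
    Integrable (fun x => p x / q x) (ρ.withDensity fun x => ENNReal.ofReal (q x)) := by
  refine ⟨(hp.div hq).aestronglyMeasurable, ?_⟩
  rw [hasFiniteIntegral_iff_ofReal (.of_forall fun x => div_nonneg (hp0 x) (hq0 x).le),
    lintegral_ofReal_div_withDensity hp hq hq0]
  exact measure_lt_top _ _

lemma integral_div_withDensity (hp : Measurable p) (hp0 : ∀ x, 0 ≤ p x) (hq : Measurable q)
    (hq0 : ∀ x, 0 < q x) :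
    ∫ x, p x / q x ∂(ρ.withDensity fun x => ENNReal.ofReal (q x)) =
      (ρ.withDensity fun x => ENNReal.ofReal (p x)).real Set.univ := by
  rw [integral_eq_lintegral_of_nonneg_ae (.of_forall fun x => div_nonneg (hp0 x) (hq0 x).le)
    (hp.div hq).aestronglyMeasurable, lintegral_ofReal_div_withDensity hp hq hq0, Measure.real]

end Ratio

/-- The density ratio of the uniform mixtures of `p` and `p'`, two families that differ in the
component `j` only, with the contribution of `p j` truncated at `c`. -/
noncomputable def truncatedMixtureRatio (c : ℝ) (p p' : ι → X → ℝ) (j : ι) (x : X) : ℝ :=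
  1 + (min (p j x / averageDensity p' x) c - p' j x / averageDensity p' x) / Fintype.card ι

theorem isApproxDensity_uniformMixture [Nonempty ι] (hp : ∀ i, Measurable (p i))
    (hp' : ∀ i, Measurable (p' i)) (hp0 : ∀ i x, 0 < p i x) (hp'0 : ∀ i x, 0 < p' i x)
    [∀ i, IsProbabilityMeasure (ρ.withDensity fun x => ENNReal.ofReal (p i x))]
    [∀ i, IsProbabilityMeasure (ρ.withDensity fun x => ENNReal.ofReal (p' i x))]
    {j : ι} (hj : ∀ i, i ≠ j → p i = p' i) (ha : 0 < a) (hc : 0 < c) {D : ℝ}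
    (hp2 : ∀ i, ∫⁻ x, ENNReal.ofReal ((p j x / p' i x) ^ 2)
      ∂(ρ.withDensity fun x => ENNReal.ofReal (p' i x)) ≤ ENNReal.ofReal (c ^ 2 / 2))
    (hp'2 : ∀ i, ∫⁻ x, ENNReal.ofReal ((p' j x / p' i x) ^ 2)
      ∂(ρ.withDensity fun x => ENNReal.ofReal (p' i x)) ≤ ENNReal.ofReal (c ^ 2 / 2))
    (hD : ∀ i, ∫⁻ x, ENNReal.ofReal (p j x / p' i x - c)
      ∂(ρ.withDensity fun x => ENNReal.ofReal (p' i x)) ≤ ENNReal.ofReal D) :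
    IsApproxDensity (uniformMixture fun i => ρ.withDensity fun x => ENNReal.ofReal (p i x))
      (uniformMixture fun i => ρ.withDensity fun x => ENNReal.ofReal (p' i x))
      (fun x => ENNReal.ofReal (truncatedMixtureRatio c p p' j x)) (1 + a)
      (ENNReal.ofReal (D / Fintype.card ι))
      (ENNReal.ofReal (Real.exp (a * (c / Fintype.card ι) * (c / Fintype.card ι) +
        (a * (c / Fintype.card ι)) ^ 2 / 2))) := by
  set q := averageDensity p' with hqdef
  have hq : Measurable q := by fun_prop
  have hq0 : ∀ x, 0 < q x := averageDensity_pos hp'0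
  set Q := uniformMixture fun i => ρ.withDensity fun x => ENNReal.ofReal (p' i x)
  have hQ : ρ.withDensity (fun x => ENNReal.ofReal (q x)) = Q :=
    withDensity_averageDensity hp' fun i x => (hp'0 i x).le
  have hP : (uniformMixture fun i => ρ.withDensity fun x => ENNReal.ofReal (p i x)) =
      Q.withDensity fun x =>
        ENNReal.ofReal (1 + (p j x / q x - p' j x / q x) / Fintype.card ι) := by
    simp_rw [hqdef, ← averageDensity_div_averageDensity hp'0 hj]
    rw [← hQ, withDensity_ofReal_withDensity_div (by fun_prop) hq hq0,
      withDensity_averageDensity hp fun i x => (hp0 i x).le]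
  have hmean : ∫ x, p j x / q x ∂Q = ∫ x, p' j x / q x ∂Q := by
    rw [← hQ, integral_div_withDensity (hp j) (fun x => (hp0 j x).le) hq hq0,
      integral_div_withDensity (hp' j) (fun x => (hp'0 j x).le) hq hq0, probReal_univ,
      probReal_univ]
  have hφ2 : ConvexOn ℝ (Set.Ici 0) fun x : ℝ => x ^ 2 := convexOn_pow 2
  have hφc : ConvexOn ℝ (Set.Ici 0) fun x : ℝ => x - c :=
    (convexOn_id (convex_Ici 0)).sub (concaveOn_const c (convex_Ici 0))
  rw [hP]
  refine isApproxDensity_of_truncation (by fun_prop) (by fun_prop)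
    (fun x => (div_pos (hp0 j x) (hq0 x)).le) (fun x => (div_pos (hp'0 j x) (hq0 x)).le)
    (div_averageDensity_le_card hp'0 j) (by simp [Fintype.card_pos]) ha hc ?_ hmean.le ?_ ?_ ?_
  all_goals rw [← hQ]
  · exact integrable_div_withDensity (hp j) (fun x => (hp0 j x).le) hq hq0
  · exact lintegral_ofReal_div_averageDensity_le hp' hp'0 hφ2 (by fun_prop) (hp j)
      (fun x => (hp0 j x).le) hp2
  · exact lintegral_ofReal_div_averageDensity_le hp' hp'0 hφ2 (by fun_prop) (hp' j)
      (fun x => (hp'0 j x).le) hp'2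
  · exact lintegral_ofReal_div_averageDensity_le hp' hp'0 hφc (by fun_prop) (hp j)
      (fun x => (hp0 j x).le) hD

end Mixtures

section Gaussian

open scoped RealInnerProductSpace

variable {E : Type*} [NormedAddCommGroup E] [InnerProductSpace ℝ E] [MeasurableSpace E]
  [BorelSpace E]

lemma ext_of_integral_exp_inner [SecondCountableTopology E] [CompleteSpace E] {μ ν : Measure E}
    [IsProbabilityMeasure μ] [IsProbabilityMeasure ν]
    (hμ : ∀ h, Integrable (fun x => Real.exp ⟪h, x⟫) μ)
    (hμν : ∀ h, ∫ x, Real.exp ⟪h, x⟫ ∂μ = ∫ x, Real.exp ⟪h, x⟫ ∂ν) : μ = ν := by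
  refine Measure.ext_of_charFun (funext fun t => ?_)
  have hmgf : mgf (fun x => ⟪t, x⟫) μ = mgf (fun x => ⟪t, x⟫) ν := by
    funext s
    simpa [mgf, real_inner_smul_left] using hμν (s • t)
  have hset : integrableExpSet (fun x => ⟪t, x⟫) μ = Set.univ :=
    Set.eq_univ_of_forall fun s => by
      simpa [integrableExpSet, real_inner_smul_left] using hμ (s • t)
  have hI := eqOn_complexMGF_of_mgf hmgf (x := Complex.I) (by simp [hset])
  simpa [complexMGF, charFun_apply, real_inner_comm t, mul_comm] using hI

lemma map_inner_stdGaussian [FiniteDimensional ℝ E] (h : E) :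
    (stdGaussian E).map (fun x => ⟪h, x⟫) = gaussianReal 0 (‖h‖ ^ 2).toNNReal := by
  have hL := IsGaussian.map_eq_gaussianReal (μ := stdGaussian E) (innerSL ℝ h)
  rw [integral_strongDual_stdGaussian, variance_dual_stdGaussian, innerSL_apply_norm] at hL
  simpa using hL

variable {d : ℕ} {v : ℝ}

lemma integral_exp_inner_isoGaussian (hv : 0 ≤ v) (m h : EuclideanSpace ℝ (Fin d)) :
    ∫ x, Real.exp ⟪h, x⟫ ∂(isoGaussian m v) = Real.exp (⟪h, m⟫ + v * ‖h‖ ^ 2 / 2) := by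
  have hstd := mgf_gaussianReal (map_inner_stdGaussian h) √v
  rw [mgf, Real.coe_toNNReal _ (sq_nonneg _), Real.sq_sqrt hv, zero_mul, zero_add] at hstd
  rw [isoGaussian, integral_map (by fun_prop) (by fun_prop)]
  simp only [inner_add_right, real_inner_smul_right, Real.exp_add, integral_const_mul, hstd,
    mul_comm v]

lemma integrable_exp_inner_isoGaussian (hv : 0 ≤ v) (m h : EuclideanSpace ℝ (Fin d)) :
    Integrable (fun x => Real.exp ⟪h, x⟫) (isoGaussian m v) :=
  .of_integral_ne_zero (by rw [integral_exp_inner_isoGaussian hv]; positivity)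

/-- The density of the normal distribution `N(m, v I)` with respect to `N(0, v I)`. -/
noncomputable def gaussianDensity (v : ℝ) (m x : EuclideanSpace ℝ (Fin d)) : ℝ :=
  Real.exp ((⟪m, x⟫ - ‖m‖ ^ 2 / 2) / v)

lemma gaussianDensity_pos (v : ℝ) (m x : EuclideanSpace ℝ (Fin d)) : 0 < gaussianDensity v m x :=
  Real.exp_pos _

@[fun_prop]
lemma measurable_gaussianDensity {X : Type*} [MeasurableSpace X]
    {f g : X → EuclideanSpace ℝ (Fin d)} (hf : Measurable f) (hg : Measurable g) :
    Measurable fun x => gaussianDensity v (f x) (g x) := by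
  unfold gaussianDensity
  fun_prop

theorem tilted_isoGaussian_zero (hv : 0 < v) (m : EuclideanSpace ℝ (Fin d)) :
    (isoGaussian 0 v).tilted (fun x => ⟪v⁻¹ • m, x⟫) = isoGaussian m v := by
  have hint := integrable_exp_inner_isoGaussian hv.le (0 : EuclideanSpace ℝ (Fin d))
  have := isProbabilityMeasure_tilted (hint (v⁻¹ • m))
  refine (ext_of_integral_exp_inner (integrable_exp_inner_isoGaussian hv.le m) fun h => ?_).symm
  simp only [integral_exp_tilted, Pi.add_apply, ← inner_add_left,
    integral_exp_inner_isoGaussian hv.le, ← Real.exp_sub]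
  congr 1
  rw [norm_add_sq_real, norm_smul, real_inner_smul_left, mul_pow, Real.norm_eq_abs, sq_abs,
    real_inner_comm, inner_zero_right, inner_zero_right]
  field_simp
  ring

theorem isoGaussian_eq_withDensity (hv : 0 < v) (m : EuclideanSpace ℝ (Fin d)) :
    isoGaussian m v =
      (isoGaussian 0 v).withDensity fun x => ENNReal.ofReal (gaussianDensity v m x) := by
  rw [← tilted_isoGaussian_zero hv, Measure.tilted]
  congr! 3 with x
  rw [integral_exp_inner_isoGaussian hv.le, ← Real.exp_sub, gaussianDensity, norm_smul, mul_pow,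
    Real.norm_eq_abs, sq_abs, real_inner_smul_left, inner_zero_right]
  congr 1
  field_simp
  ring

lemma gaussianDensity_div_rpow (hv : 0 < v) (m m' x : EuclideanSpace ℝ (Fin d)) (α : ℝ) :
    (gaussianDensity v m x / gaussianDensity v m' x) ^ α =
      Real.exp ⟪(α / v) • (m - m'), x⟫ * Real.exp (-(α * (‖m‖ ^ 2 - ‖m'‖ ^ 2) / (2 * v))) := by
  rw [gaussianDensity, gaussianDensity, ← Real.exp_sub, ← Real.exp_mul, ← Real.exp_add,
    real_inner_smul_left, inner_sub_left]
  congr 1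
  field_simp
  ring

theorem lintegral_gaussianDensity_div_rpow (hv : 0 < v) (m m' : EuclideanSpace ℝ (Fin d)) (α : ℝ) :
    ∫⁻ x, ENNReal.ofReal ((gaussianDensity v m x / gaussianDensity v m' x) ^ α)
      ∂(isoGaussian m' v) = ENNReal.ofReal (Real.exp (α * (α - 1) * ‖m - m'‖ ^ 2 / (2 * v))) := by
  simp only [gaussianDensity_div_rpow hv]
  rw [← ofReal_integral_eq_lintegral_ofReal
    ((integrable_exp_inner_isoGaussian hv.le m' _).mul_const _) (.of_forall fun x => by positivity),
    integral_mul_const, integral_exp_inner_isoGaussian hv.le, ← Real.exp_add]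
  congr 2
  rw [norm_smul, mul_pow, Real.norm_eq_abs, sq_abs, real_inner_smul_left, inner_sub_left,
    real_inner_self_eq_norm_sq, norm_sub_sq_real]
  field_simp
  ring

-- Bernoulli's inequality for `(x / c) ^ (k + 1)`.
lemma sub_le_rpow_div {x c k : ℝ} (hx : 0 ≤ x) (hc : 0 < c) (hk : 0 ≤ k) :
    x - c ≤ x ^ (k + 1) * c ^ (-k) / (k + 1) := by
  have hbernoulli := one_add_mul_self_le_rpow_one_add (s := x / c - 1) (p := k + 1)
    (by linarith [div_nonneg hx hc.le]) (by linarith)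
  rw [add_sub_cancel, Real.div_rpow hx hc.le, Real.rpow_add_one hc.ne' k] at hbernoulli
  rw [Real.rpow_neg hc.le, le_div_iff₀ (by linarith)]
  have hck : 0 < c ^ k := by positivity
  field_simp at hbernoulli ⊢
  nlinarith

-- The moment of order `2 L + 1` nearly minimises the bound that `sub_le_rpow_div` gives.
lemma lintegral_gaussianDensity_div_sub_exp_one_le (hv : 0 < v) {m m' : EuclideanSpace ℝ (Fin d)}
    {L : ℝ} (hL : 1 ≤ L) (hm : 2 * L * ‖m - m'‖ ^ 2 ≤ v) :
    ∫⁻ x, ENNReal.ofReal (gaussianDensity v m x / gaussianDensity v m' x - Real.exp 1)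
      ∂(isoGaussian m' v) ≤ ENNReal.ofReal (5 / 4 * Real.exp (-L)) := by
  have hmoment : (2 * L + 1) * (2 * L + 1 - 1) * ‖m - m'‖ ^ 2 / (2 * v) ≤ L + 1 / 2 := by
    rw [div_le_iff₀ (by positivity)]
    nlinarith
  have hexp : Real.exp (1 / 2) ≤ 5 / 4 * (2 * L + 1) := by
    nlinarith [Real.exp_one_lt_d9, Real.exp_pos (1 / 2), Real.exp_add (1 / 2) (1 / 2)]
  calc ∫⁻ x, ENNReal.ofReal (gaussianDensity v m x / gaussianDensity v m' x - Real.exp 1)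
        ∂(isoGaussian m' v)
      ≤ ∫⁻ x, ENNReal.ofReal ((gaussianDensity v m x / gaussianDensity v m' x) ^ (2 * L + 1)) *
          ENNReal.ofReal (Real.exp 1 ^ (-(2 * L)) / (2 * L + 1)) ∂(isoGaussian m' v) := by
        refine lintegral_mono fun x => ?_
        have hratio := (div_pos (gaussianDensity_pos v m x) (gaussianDensity_pos v m' x)).le
        rw [← ENNReal.ofReal_mul (by positivity), ← mul_div_assoc]
        exact ENNReal.ofReal_le_ofReal (sub_le_rpow_div hratio (Real.exp_pos 1) (by linarith))
    _ = ENNReal.ofReal (Real.exp ((2 * L + 1) * (2 * L + 1 - 1) * ‖m - m'‖ ^ 2 / (2 * v)) *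
          (Real.exp 1 ^ (-(2 * L)) / (2 * L + 1))) := by
        rw [lintegral_mul_const _ (by fun_prop), lintegral_gaussianDensity_div_rpow hv,
          ← ENNReal.ofReal_mul (by positivity)]
    _ ≤ ENNReal.ofReal (Real.exp (L + 1 / 2) * (Real.exp (-(2 * L)) / (2 * L + 1))) := by
        rw [← Real.exp_mul, one_mul]
        gcongr
    _ ≤ ENNReal.ofReal (5 / 4 * Real.exp (-L)) := by
        refine ENNReal.ofReal_le_ofReal ?_
        rw [← mul_div_assoc, ← Real.exp_add, div_le_iff₀ (by linarith),
          show L + 1 / 2 + -(2 * L) = 1 / 2 + -L by ring, Real.exp_add]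
        nlinarith [Real.exp_pos (-L)]

lemma lintegral_gaussianDensity_div_sq_le (hv : 0 < v) {m m' : EuclideanSpace ℝ (Fin d)}
    (hm : 2 * ‖m - m'‖ ^ 2 ≤ v) :
    ∫⁻ x, ENNReal.ofReal ((gaussianDensity v m x / gaussianDensity v m' x) ^ 2)
      ∂(isoGaussian m' v) ≤ ENNReal.ofReal (Real.exp 1 ^ 2 / 2) := by
  have hchi := lintegral_gaussianDensity_div_rpow hv m m' 2
  simp only [Real.rpow_two] at hchi
  rw [hchi]
  refine ENNReal.ofReal_le_ofReal ?_
  have hexponent : 2 * (2 - 1) * ‖m - m'‖ ^ 2 / (2 * v) ≤ 1 := by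
    rw [div_le_one (by positivity)]
    linarith
  have he : 2 ≤ Real.exp 1 := by linarith [Real.exp_one_gt_d9]
  calc Real.exp (2 * (2 - 1) * ‖m - m'‖ ^ 2 / (2 * v)) ≤ Real.exp 1 := Real.exp_le_exp.2 hexponent
    _ ≤ Real.exp 1 ^ 2 / 2 := by nlinarith

theorem isApproxDensity_gaussianMixture {ι : Type*} [Fintype ι] [Nonempty ι] (hv : 0 < v)
    {m m' : ι → EuclideanSpace ℝ (Fin d)} {j : ι} (hj : ∀ i, i ≠ j → m i = m' i) {L a : ℝ}
    (hL : 1 ≤ L) (hm : ∀ i, 2 * L * ‖m j - m' i‖ ^ 2 ≤ v)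
    (hm' : ∀ i, 2 * L * ‖m' j - m' i‖ ^ 2 ≤ v) (ha : 0 < a) :
    IsApproxDensity (uniformMixture fun i => isoGaussian (m i) v)
      (uniformMixture fun i => isoGaussian (m' i) v)
      (fun x => ENNReal.ofReal (truncatedMixtureRatio (Real.exp 1)
        (fun i => gaussianDensity v (m i)) (fun i => gaussianDensity v (m' i)) j x)) (1 + a)
      (ENNReal.ofReal (5 / 4 * Real.exp (-L) / Fintype.card ι))
      (ENNReal.ofReal (Real.exp (a * (Real.exp 1 / Fintype.card ι) * (Real.exp 1 / Fintype.card ι) +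
        (a * (Real.exp 1 / Fintype.card ι)) ^ 2 / 2))) := by
  have hdens (i) := isoGaussian_eq_withDensity hv (m i)
  have hdens' (i) := isoGaussian_eq_withDensity hv (m' i)
  have hprob : ∀ i, IsProbabilityMeasure ((isoGaussian 0 v).withDensity fun x =>
      ENNReal.ofReal (gaussianDensity v (m i) x)) := fun i => hdens i ▸ inferInstance
  have hprob' : ∀ i, IsProbabilityMeasure ((isoGaussian 0 v).withDensity fun x =>
      ENNReal.ofReal (gaussianDensity v (m' i) x)) := fun i => hdens' i ▸ inferInstance
  have hsq {r : ℝ} (hr : 2 * L * r ^ 2 ≤ v) : 2 * r ^ 2 ≤ v := by nlinarith [sq_nonneg r]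
  simp only [hdens, hdens']
  refine isApproxDensity_uniformMixture (fun i => by fun_prop) (fun i => by fun_prop)
    (fun i => gaussianDensity_pos v (m i)) (fun i => gaussianDensity_pos v (m' i))
    (fun i hi => by rw [hj i hi]) ha (Real.exp_pos 1) ?_ ?_ ?_
  all_goals intro i; rw [← hdens' i]
  · exact lintegral_gaussianDensity_div_sq_le hv (hsq (hm i))
  · exact lintegral_gaussianDensity_div_sq_le hv (hsq (hm' i))
  · exact lintegral_gaussianDensity_div_sub_exp_one_le hv hL (hm i)

end Gaussian

section NoisySGD

variable {Z : Type*} {n d : ℕ} {ℓ : EuclideanSpace ℝ (Fin d) → Z → ℝ}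
  {S S' : Fin n → Z} {G β₀ : ℝ}

lemma norm_gradientStep_sub_sq_le {E : Type*} [NormedAddCommGroup E] [NormedSpace ℝ E]
    {u u' : E} (hu : ‖u‖ ≤ G) (hu' : ‖u'‖ ≤ G) (η lam : ℝ) (w : E) :
    ‖(1 - lam * η) • (w - η • u) - (1 - lam * η) • (w - η • u')‖ ^ 2 ≤
      ((1 - lam * η) * (η * (2 * G))) ^ 2 := by
  rw [← smul_sub, sub_sub_sub_cancel_left, ← smul_sub, norm_smul, norm_smul, ← mul_assoc,
    ← mul_assoc, mul_pow, mul_pow _ (2 * G), ← norm_mul, Real.norm_eq_abs, sq_abs]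
  gcongr
  linarith [norm_sub_le u' u]

lemma exists_isApproxDensity_sgldStep [NeZero n]
    (hgrad : ∀ w z, ‖gradient (fun u => ℓ u z) w‖ ≤ G)
    {j : Fin n} (hj : ∀ i, i ≠ j → S i = S' i) {η lam L a : ℝ}
    (hv : 0 < lam * η * (2 - lam * η) * β₀) (hL : 1 ≤ L)
    (hsens : 2 * L * ((1 - lam * η) * (η * (2 * G))) ^ 2 ≤ lam * η * (2 - lam * η) * β₀)
    (ha : 0 < a) :
    ∃ g : EuclideanSpace ℝ (Fin d) → EuclideanSpace ℝ (Fin d) → ℝ≥0∞,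
      Measurable (Function.uncurry g) ∧
      ∀ w, IsApproxDensity (sgldStep ℓ η lam β₀ S w) (sgldStep ℓ η lam β₀ S' w) (g w) (1 + a)
        (ENNReal.ofReal (5 / 4 * Real.exp (-L) / n))
        (ENNReal.ofReal (Real.exp (a * (Real.exp 1 / n) * (Real.exp 1 / n) +
          (a * (Real.exp 1 / n)) ^ 2 / 2))) := by
  let mean (S : Fin n → Z) (w : EuclideanSpace ℝ (Fin d)) (i : Fin n) :=
    (1 - lam * η) • (w - η • gradient (fun u => ℓ u (S i)) w)
  set v := lam * η * (2 - lam * η) * β₀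
  have hmean (S : Fin n → Z) (i : Fin n) : Measurable fun w => mean S w i :=
    (measurable_id.sub ((measurable_gradient _).const_smul η)).const_smul (1 - lam * η)
  have hstep (S : Fin n → Z) (w : EuclideanSpace ℝ (Fin d)) :
      sgldStep ℓ η lam β₀ S w = uniformMixture fun i => isoGaussian (mean S w i) v := by
    simp [sgldStep, uniformMixture, mean, v]
  have hclose (w : EuclideanSpace ℝ (Fin d)) (z z' : Z) :=
    (mul_le_mul_of_nonneg_left (norm_gradientStep_sub_sq_le (hgrad w z) (hgrad w z') η lam w)
      (by linarith : (0 : ℝ) ≤ 2 * L)).trans hsens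
  refine ⟨fun w x => ENNReal.ofReal (truncatedMixtureRatio (Real.exp 1)
    (fun i => gaussianDensity v (mean S w i)) (fun i => gaussianDensity v (mean S' w i)) j x),
    ?_, fun w => ?_⟩
  · have (S : Fin n → Z) (i : Fin n) : Measurable
        fun q : EuclideanSpace ℝ (Fin d) × EuclideanSpace ℝ (Fin d) =>
          gaussianDensity v (mean S q.1 i) q.2 := by fun_prop
    unfold truncatedMixtureRatio averageDensity Function.uncurry
    fun_prop
  · rw [hstep, hstep]
    have hmix := isApproxDensity_gaussianMixture (m := mean S w) (m' := mean S' w) hv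
      (fun i hi => by simp only [mean, hj i hi]) hL (fun i => hclose w (S j) (S' i))
      (fun i => hclose w (S' j) (S' i)) ha
    rwa [Fintype.card_fin] at hmix

theorem exists_isApproxDensity_sgldLaw [NeZero n] {η lam : ℕ → ℝ} {p : ℝ} (hp : 0 ≤ p)
    {D : ℕ → ℝ≥0∞} {M : ℝ≥0∞}
    (hstep : ∀ t, 2 ≤ t → ∃ g : EuclideanSpace ℝ (Fin d) → EuclideanSpace ℝ (Fin d) → ℝ≥0∞,
      Measurable (Function.uncurry g) ∧
      ∀ w, IsApproxDensity (sgldStep ℓ (η t) (lam t) β₀ S w) (sgldStep ℓ (η t) (lam t) β₀ S' w)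
        (g w) p (D t) M) (T : ℕ) :
    ∃ f, IsApproxDensity (sgldLaw ℓ η lam β₀ T S) (sgldLaw ℓ η lam β₀ T S') f p
      (∑ t ∈ Finset.Ioc 1 T, D t) (M ^ (T - 1)) := by
  have hsnoc (t : ℕ) := measurable_fin_snoc (X := EuclideanSpace ℝ (Fin d)) t
  have hinit (t : ℕ) : Measurable fun x : Fin (t + 1) → EuclideanSpace ℝ (Fin d) =>
      ((Fin.init x : Fin t → EuclideanSpace ℝ (Fin d)), x (Fin.last t)) := by
    unfold Fin.init
    fun_prop
  have hinit_snoc (t : ℕ) : Function.LeftInverse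
      (fun x : Fin (t + 1) → EuclideanSpace ℝ (Fin d) =>
        ((Fin.init x : Fin t → EuclideanSpace ℝ (Fin d)), x (Fin.last t)))
      fun q => Fin.snoc (α := fun _ => EuclideanSpace ℝ (Fin d)) q.1 q.2 := fun q => by simp
  induction T with
  | zero => exact ⟨_, by simpa [sgldLaw] using IsApproxDensity.refl _ p⟩
  | succ t ih =>
    obtain ⟨f, hf⟩ := ih
    rcases t with _ | t
    · have hfirst : sgldLaw ℓ η lam β₀ 1 S = sgldLaw ℓ η lam β₀ 1 S' := rfl
      exact ⟨_, by simpa [hfirst] using IsApproxDensity.refl (sgldLaw ℓ η lam β₀ 1 S') p⟩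
    · obtain ⟨g, hg, hgK⟩ := hstep (t + 2) (by lia)
      rw [Finset.sum_Ioc_succ_top (by lia), Nat.add_sub_cancel, pow_succ]
      refine ⟨_, IsApproxDensity.map (hf.compProd (g := fun x => g (x (Fin.last t))) hp ?_
        fun x => hgK (x (Fin.last t))) (hsnoc _) (hinit _) (hinit_snoc _)⟩
      fun_prop

end NoisySGD

section Schedule

open Real

lemma stepSize_pos {G β₀ L t : ℝ} (hG : 0 < G) (hβ₀ : 0 < β₀) (hL : 0 < L) (ht : 0 < t) :
    0 < G⁻¹ * √β₀ / √(8 * L * t) := by positivity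

lemma stepSize_sq {G β₀ L t : ℝ} (hβ₀ : 0 ≤ β₀) (hL : 0 ≤ L) (ht : 0 ≤ t) :
    (G⁻¹ * √β₀ / √(8 * L * t)) ^ 2 = β₀ / (8 * G ^ 2 * (L * t)) := by
  rw [div_pow, mul_pow, sq_sqrt hβ₀, sq_sqrt (by positivity), inv_pow]
  field_simp

lemma sensitivity_le_noiseVariance {G β₀ L L' t η η' lam : ℝ} (hG : 0 < G) (hβ₀ : 0 < β₀)
    (hL' : 0 < L') (hL'L : L' ≤ L) (ht : 1 < t) (hη : η = G⁻¹ * √β₀ / √(8 * L * t))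
    (hη' : η' = G⁻¹ * √β₀ / √(8 * L' * (t - 1))) (hlam : lam = 1 / η - 1 / η') :
    0 < lam * η * (2 - lam * η) * β₀ ∧
      2 * L * ((1 - lam * η) * (η * (2 * G))) ^ 2 ≤ lam * η * (2 - lam * η) * β₀ := by
  have hL : 0 < L := hL'.trans_le hL'L
  have ht1 : 0 < t - 1 := by linarith
  have hη0 : 0 < η := hη ▸ stepSize_pos hG hβ₀ hL (by linarith)
  have hη'0 : 0 < η' := hη' ▸ stepSize_pos hG hβ₀ hL' ht1
  have hηsq : η ^ 2 = β₀ / (8 * G ^ 2 * (L * t)) :=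
    hη ▸ stepSize_sq hβ₀.le hL.le (by linarith)
  have hη'sq : η' ^ 2 = β₀ / (8 * G ^ 2 * (L' * (t - 1))) :=
    hη' ▸ stepSize_sq hβ₀.le hL'.le ht1.le
  have hratio : 1 - lam * η = η / η' := by
    rw [hlam]
    field_simp
    ring
  have hratiosq : (1 - lam * η) ^ 2 = L' * (t - 1) / (L * t) := by
    rw [hratio, div_pow, hηsq, hη'sq]
    field_simp
  have hdecay : (1 - lam * η) ^ 2 * (t + 1) ≤ t := by
    rw [hratiosq, div_mul_eq_mul_div, div_le_iff₀ (by positivity)]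
    nlinarith [mul_nonneg (sub_nonneg.2 hL'L) (by nlinarith : (0 : ℝ) ≤ t ^ 2 - 1)]
  have hvar : lam * η * (2 - lam * η) * β₀ = (1 - (1 - lam * η) ^ 2) * β₀ := by ring
  have hsens : 2 * L * ((1 - lam * η) * (η * (2 * G))) ^ 2 = (1 - lam * η) ^ 2 / t * β₀ := by
    rw [mul_pow, mul_pow η, hηsq]
    field_simp
    ring
  rw [hvar, hsens]
  refine ⟨mul_pos (by nlinarith) hβ₀, ?_⟩
  gcongr
  rw [div_le_iff₀ (by linarith)]
  linarith

lemma one_le_log_schedule {b t : ℝ} (hb : 0 < b) (hb' : b < 5 / 2) (ht : 2 ≤ t) :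
    1 ≤ log (2.5 * t ^ 2 / b) := by
  rw [le_log_iff_exp_le (by positivity), le_div_iff₀ hb]
  nlinarith [exp_one_lt_d9, exp_pos 1]

lemma log_schedule_pos {b t : ℝ} (hb : 0 < b) (hb' : b < 5 / 2) (ht : 1 ≤ t) :
    0 < log (2.5 * t ^ 2 / b) := by
  refine log_pos ((one_lt_div hb).2 ?_)
  nlinarith

lemma sum_Ioc_div_two_mul_sq_le {δ : ℝ} (hδ : 0 ≤ δ) (T : ℕ) :
    ∑ t ∈ Finset.Ioc 1 T, δ / (2 * (t : ℝ) ^ 2) ≤ δ / 2 := by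
  rcases le_or_gt 1 T with hT | hT
  · have hinv := sum_Ioc_inv_sq_le_sub (α := ℝ) one_ne_zero hT
    calc ∑ t ∈ Finset.Ioc 1 T, δ / (2 * (t : ℝ) ^ 2)
        = δ / 2 * ∑ t ∈ Finset.Ioc 1 T, ((t : ℝ) ^ 2)⁻¹ := by
          rw [Finset.mul_sum]
          exact Finset.sum_congr rfl fun t _ => by rw [div_mul_eq_div_div, div_eq_mul_inv]
      _ ≤ δ / 2 * 1 := by
          gcongr
          exact hinv.trans (by simp)
      _ = δ / 2 := mul_one _
  · rw [Finset.Ioc_eq_empty_of_le hT.le, Finset.sum_empty]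
    positivity

lemma exists_moment_exponent {s Λ T : ℝ} (hs : 0 < s) (hΛ : 0 < Λ) (hT : 0 < T) :
    ∃ a > 0, T * (a * s * s + (a * s) ^ 2 / 2) - a * (√(2 * T * Λ) * s + T * s ^ 2) = -Λ := by
  have hsqrt : √(2 * T * Λ) ^ 2 = 2 * T * Λ := sq_sqrt (by positivity)
  refine ⟨√(2 * T * Λ) / (T * s), by positivity, ?_⟩
  generalize √(2 * T * Λ) = r at hsqrt ⊢
  field_simp
  linear_combination -hsqrt

lemma exists_exp_neg_mul_pow_le {s δ : ℝ} (hs : 0 < s) (hδ : 0 < δ) (hδ2 : δ < 2) {T : ℕ}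
    (hT : 0 < T) :
    ∃ a > 0, exp (-a * (√(2 * T * log (2 / δ)) * s + T * s ^ 2)) *
      exp (a * s * s + (a * s) ^ 2 / 2) ^ (T - 1) ≤ δ / 2 := by
  obtain ⟨a, ha, hexponent⟩ := exists_moment_exponent hs
    (log_pos ((one_lt_div hδ).2 hδ2)) (Nat.cast_pos.2 hT)
  refine ⟨a, ha, ?_⟩
  calc exp (-a * (√(2 * T * log (2 / δ)) * s + T * s ^ 2)) *
        exp (a * s * s + (a * s) ^ 2 / 2) ^ (T - 1)
      ≤ exp (-a * (√(2 * T * log (2 / δ)) * s + T * s ^ 2)) *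
        exp (a * s * s + (a * s) ^ 2 / 2) ^ T := by
        gcongr
        · exact one_le_exp (by positivity)
        · exact Nat.sub_le T 1
    _ = exp (-log (2 / δ)) := by
        rw [← exp_nat_mul, ← exp_add, ← hexponent]
        ring_nf
    _ = δ / 2 := by rw [exp_neg, exp_log (by positivity), inv_div]

end Schedule

section Privacy

variable {Z : Type*} {n d : ℕ} [NeZero n]

lemma Neighboring.exists_forall_ne_eq {S S' : Fin n → Z} (h : Neighboring S S') :
    ∃ j, ∀ i, i ≠ j → S i = S' i := by
  by_cases hdiff : ∃ j, S j ≠ S' j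
  · obtain ⟨j, hj⟩ := hdiff
    exact ⟨j, fun i hij => by_contra fun hi => hij (h hi hj)⟩
  · push Not at hdiff
    exact ⟨0, fun i _ => hdiff i⟩

lemma truncationError_eq {δ : ℝ} (hδ : 0 < δ) {t : ℝ} (ht : 0 < t) :
    5 / 4 * Real.exp (-Real.log (2.5 * t ^ 2 / (n * δ))) / n = δ / (2 * t ^ 2) := by
  have hn : (0 : ℝ) < n := Nat.cast_pos.2 (NeZero.pos n)
  rw [Real.exp_neg, Real.exp_log (by positivity)]
  field_simp
  norm_num

theorem exists_isApproxDensity_sgldLaw_of_schedule {ℓ : EuclideanSpace ℝ (Fin d) → Z → ℝ}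
    {G β₀ δ : ℝ} (hG : 0 < G) (hgrad : ∀ w z, ‖gradient (fun u => ℓ u z) w‖ ≤ G)
    (hβ₀ : 0 < β₀) (hδ : 0 < δ) (hnδ : n * δ < 5 / 2) {η lam : ℕ → ℝ}
    (hη : ∀ t : ℕ, 1 ≤ t →
      η t = G⁻¹ * √β₀ / √(8 * Real.log (2.5 * (t : ℝ) ^ 2 / (n * δ)) * t))
    (hlam : ∀ t : ℕ, 2 ≤ t → lam t = 1 / η t - 1 / η (t - 1)) {S S' : Fin n → Z}
    (hSS' : Neighboring S S') (T : ℕ) {a : ℝ} (ha : 0 < a) :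
    ∃ f, IsApproxDensity (sgldLaw ℓ η lam β₀ T S) (sgldLaw ℓ η lam β₀ T S') f (1 + a)
      (ENNReal.ofReal (∑ t ∈ Finset.Ioc 1 T, δ / (2 * (t : ℝ) ^ 2)))
      (ENNReal.ofReal (Real.exp (a * (Real.exp 1 / n) * (Real.exp 1 / n) +
        (a * (Real.exp 1 / n)) ^ 2 / 2) ^ (T - 1))) := by
  have hb : 0 < n * δ := mul_pos (Nat.cast_pos.2 (NeZero.pos n)) hδ
  obtain ⟨j, hj⟩ := hSS'.exists_forall_ne_eq
  rw [ENNReal.ofReal_sum_of_nonneg fun t _ => by positivity,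
    ENNReal.ofReal_pow (Real.exp_pos _).le]
  refine exists_isApproxDensity_sgldLaw (by linarith) (fun t ht => ?_) T
  have ht2 : (2 : ℝ) ≤ t := Nat.ofNat_le_cast.2 ht
  have hη' := hη (t - 1) (by lia)
  rw [Nat.cast_pred (by lia)] at hη'
  have hlog : Real.log (2.5 * ((t : ℝ) - 1) ^ 2 / (n * δ)) ≤
      Real.log (2.5 * (t : ℝ) ^ 2 / (n * δ)) := by
    have : (0 : ℝ) < t - 1 := by linarith
    gcongr
    linarith
  obtain ⟨hvar, hsens⟩ := sensitivity_le_noiseVariance hG hβ₀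
    (log_schedule_pos hb hnδ (by linarith)) hlog (by linarith) (hη t (by lia)) hη' (hlam t ht)
  rw [← truncationError_eq (n := n) hδ (by linarith)]
  exact exists_isApproxDensity_sgldStep hgrad hj hvar (one_le_log_schedule hb hnδ ht2) hsens ha

end Privacy

theorem mainTheorem5 {Z : Type*} {n d : ℕ} [NeZero n] (T : ℕ)
    (ℓ : EuclideanSpace ℝ (Fin d) → Z → ℝ) (G β₀ δ : ℝ)
    (hdiff : ∀ z, Differentiable ℝ (fun w => ℓ w z))
    (hG : 0 < G) (hgrad : ∀ w z, ‖gradient (fun u => ℓ u z) w‖ ≤ G)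
    (hβ₀ : 0 < β₀) (hδ : 0 < δ) (hδ1 : δ ≤ 1) (hnδ : n * δ < 5 / 2)
    (η lam : ℕ → ℝ)
    (hη : ∀ t : ℕ, 1 ≤ t →
      η t = G⁻¹ * √β₀ / √(8 * Real.log (2.5 * (t : ℝ) ^ 2 / (n * δ)) * t))
    (hlam : ∀ t : ℕ, 2 ≤ t → lam t = 1 / η t - 1 / η (t - 1)) :
    IsDP (fun S : Fin n → Z => sgldLaw ℓ η lam β₀ T S)
      (√(2 * T * Real.log (2 / δ)) * Real.exp 1 / n + T * Real.exp 1 ^ 2 / (n : ℝ) ^ 2) δ := by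
  intro S S' hSS' F hF
  rcases Nat.eq_zero_or_pos T with rfl | hT
  · simpa [sgldLaw] using hδ.le
  have hs : 0 < Real.exp 1 / (n : ℝ) :=
    div_pos (Real.exp_pos 1) (Nat.cast_pos.2 (NeZero.pos n))
  obtain ⟨a, ha, htail⟩ := exists_exp_neg_mul_pow_le hs hδ (by linarith) hT
  obtain ⟨f, hf⟩ := exists_isApproxDensity_sgldLaw_of_schedule hG hgrad hβ₀ hδ hnδ hη hlam
    hSS' T ha
  have hbound := hf.measureReal_le ha (by positivity) (by positivity)
    (√(2 * T * Real.log (2 / δ)) * (Real.exp 1 / n) + T * (Real.exp 1 / n) ^ 2) hF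
  have herror := sum_Ioc_div_two_mul_sq_le hδ.le T
  rw [mul_div_assoc, mul_div_assoc, ← div_pow]
  linarith
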